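/- Let $M_d$ be the algebra of complex $d\times d$ matrices. For real $p\ge 1$ let $\|A\|_p=(\mathrm{Tr}\,|A|^p)^{1/p}$, $|A|=(AA^*)^{1/2}$, be the Schatten norm, and for a linear map $L:M_d\to M_{d'}$ put $$\|L\|_{q\to p}=\sup_{0\ne A\in M_d}\frac{\|L(A)\|_p}{\|A\|_q},\qquad q,p\ge 1 .$$ A linear map $L:M_d\to M_{d'}$ is completely positive if $\mathrm{id}_n\otimes L$ maps positive semidefinite matrices to positive semidefinite matrices for every $n\ge 1$. For a completely positive map $\Phi:M_d\to M_{d'}$ the potential output purity is $$\|\Phi\|^{(\mathrm{pot})}_{q\to p}=\sup_{n,m\ge 1}\ \sup_{\Omega}\ \frac{\|\Phi\otimes\Omega\|_{q\to p}}{\|\Omega\|_{q\to p}},$$ where $\Omega$ runs over all nonzero completely positive maps $M_n\to M_m$ (restricting to $m=n$ does not change the supremum). The Choi matrix of $\Phi$ is $X_\Phi=\sum_{i,j=1}^d |i\rangle\langle j|\otimes\Phi(|i\rangle\langle j|)$. Theorem. Let $\Phi:M_d\to M_{d'}$ be completely positive and let $q,p\ge 1$ be real numbers with $q\le 2\le p$,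 or $2<q<p$, or $q<p<2$. Then $$\|\Phi\|^{(\mathrm{pot})}_{q\to p}\le \alpha(q,p)\,\|X_\Phi\|_2,\qquad \alpha(q,p)=\begin{cases}1 & q\le 2\le p,\\ d^{\,1-2/q} & 2<q<p,\\ (d')^{\,2/p-1} & q<p<2.\end{cases}$$ -/

import Mathlib

open scoped ENNReal Kronecker MatrixOrder ComplexOrder

noncomputable section

namespace OutputPurity

/-- The Schatten norm `‖A‖_p = (Tr |A|^p)^(1/p)`, where `|A| = (A A*)^(1/2)`. -/
def schattenNorm {ι : Type*} [Fintype ι] [DecidableEq ι] (p : ℝ) (A : Matrix ι ι ℂ) : ℝ :=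
  (((CFC.sqrt (A * A.conjTranspose)) ^ p).trace.re) ^ (1 / p)

/-- A linear map `M_ι → M_κ` between complex matrix algebras. -/
abbrev Superoperator (ι κ : Type*) : Type _ := Matrix ι ι ℂ →ₗ[ℂ] Matrix κ κ ℂ

section Maps

variable {ι κ ν μ : Type*} [Fintype ι] [DecidableEq ι] [Fintype κ] [DecidableEq κ]
  [Fintype ν] [DecidableEq ν] [Fintype μ] [DecidableEq μ]

/-- The tensor product `Φ ⊗ Ω` of two linear maps, where `M_ι ⊗ M_ν` is identified with the
matrices indexed by pairs through the Kronecker product. -/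
def tensorMap (Φ : Superoperator ι κ) (Ω : Superoperator ν μ) :
    Superoperator (ι × ν) (κ × μ) :=
  (kroneckerLinearEquiv κ κ μ μ ℂ).toLinearMap ∘ₗ TensorProduct.map Φ Ω ∘ₗ
    (kroneckerLinearEquiv ι ι ν ν ℂ).symm.toLinearMap

/-- `(Φ ⊗ Ω)(A ⊗ B) = Φ(A) ⊗ Ω(B)`. -/
theorem tensorMap_kronecker (Φ : Superoperator ι κ) (Ω : Superoperator ν μ)
    (A : Matrix ι ι ℂ) (B : Matrix ν ν ℂ) :
    tensorMap Φ Ω (A ⊗ₖ B) = Φ A ⊗ₖ Ω B := by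
  simp [tensorMap]

/-- `Φ` is completely positive: `id_n ⊗ Φ` preserves positive semidefiniteness for all `n ≥ 1`. -/
def IsCompletelyPositive (Φ : Superoperator ι κ) : Prop :=
  ∀ n : ℕ, 1 ≤ n → ∀ A : Matrix (Fin n × ι) (Fin n × ι) ℂ, A.PosSemidef →
    (tensorMap (LinearMap.id : Superoperator (Fin n) (Fin n)) Φ A).PosSemidef

/-- The operator norm `‖L‖_{q → p} = sup_A ‖L(A)‖_p / ‖A‖_q`, the supremum being over all nonzero
matrices `A`, as an extended nonnegative real. -/
def outputPurity (q p : ℝ) (L : Superoperator ι κ) : ℝ≥0∞ :=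
  ⨆ (A : Matrix ι ι ℂ) (_ : A ≠ 0), ENNReal.ofReal (schattenNorm p (L A) / schattenNorm q A)

/-- The potential output purity: the supremum of `‖Φ ⊗ Ω‖_{q → p} / ‖Ω‖_{q → p}` over all
dimensions `n, m ≥ 1` and all nonzero completely positive maps `Ω : M_n → M_m`. (Restricting to
`m = n` gives the same supremum, since matrices can be padded by zeros.) -/
def potentialPurity (q p : ℝ) (Φ : Superoperator ι κ) : ℝ≥0∞ :=
  ⨆ (n : ℕ) (_ : 1 ≤ n) (m : ℕ) (_ : 1 ≤ m) (Ω : Superoperator (Fin n) (Fin m))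
    (_ : IsCompletelyPositive Ω) (_ : Ω ≠ 0),
    outputPurity q p (tensorMap Φ Ω) / outputPurity q p Ω

/-- The Choi matrix `X_L = ∑ i j, |i⟩⟨j| ⊗ L(|i⟩⟨j|)`. -/
def choiMatrix (L : Superoperator ι κ) : Matrix (ι × κ) (ι × κ) ℂ :=
  ∑ i : ι, ∑ j : ι, Matrix.single i j (1 : ℂ) ⊗ₖ L (Matrix.single i j 1)

end Maps

end OutputPurity

end

/-! Write `Φ ⊗ Ω` in blocks. The block of `(Φ ⊗ Ω)(A)` at `(k, l)` is `Ω` applied to the combination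
of the input blocks `A i j` with coefficients `Φ(E i j) k l`, which are exactly the entries of the
Choi matrix. The triangle inequality, the bound `‖Ω‖_{q → p}` and Cauchy–Schwarz over `(i, j)` bound
the square of its `p`-norm by `‖Ω‖² · ∑ |Φ(E i j) k l|² · ∑ ‖A i j‖_q²`; summing over `(k, l)` turns
the first sum into `‖X_Φ‖_2²` (`schattenNorm_tensorMap_le`).

What remains is to compare a Schatten norm with the `ℓ²` sum of the norms of its blocks. For `p ≥
2`, `‖B‖_p² ≤ ∑ ‖B k l‖_p²`, and for `q ≤ 2` the inequality reverses; these come from Minkowski's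
inequality, direct or reversed, for `A A*` at exponent `p / 2`. The opposite comparisons, needed
when both exponents lie on the same side of 2, come from pinching `A* A` to its diagonal blocks,
followed by a power mean over the blocks, whose number produces the dimensional factor.

All Schatten quantities are expressed through `spectralSum`, defined by roots of the characteristic
polynomial, so that rectangular blocks cause no trouble. -/

namespace OutputPurity

open Matrix

/-! ### Spectral sums, Jensen's inequality on diagonals, and pinching. -/

section SpectralSum

variable {m n κ : Type*} [Fintype m] [DecidableEq m] [Fintype n] [DecidableEq n]
  [Fintype κ] [DecidableEq κ]

/-- The sum `∑ f (Re z)` over the eigenvalues `z` of a matrix, with algebraic multiplicity. -/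
noncomputable def spectralSum (f : ℝ → ℝ) (H : Matrix n n ℂ) : ℝ :=
  (H.charpoly.roots.map fun z => f z.re).sum

theorem spectralSum_mul_comm (f : ℝ → ℝ) (A B : Matrix n n ℂ) :
    spectralSum f (A * B) = spectralSum f (B * A) := by
  rw [spectralSum, charpoly_mul_comm, spectralSum]

/-- The characteristic polynomials of `A * B` and `B * A` differ by a power of `X`; the extra roots
are zeros, where `f` vanishes. -/
theorem spectralSum_mul_comm_rect {f : ℝ → ℝ} (hf : f 0 = 0) (A : Matrix m n ℂ)
    (B : Matrix n m ℂ) : spectralSum f (A * B) = spectralSum f (B * A) := by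
  rcases le_total (Fintype.card n) (Fintype.card m) with h | h
  · rw [spectralSum, charpoly_mul_comm_of_le A B h,
      Polynomial.roots_mul (mul_ne_zero (pow_ne_zero _ Polynomial.X_ne_zero)
        (charpoly_monic (B * A)).ne_zero)]
    simp [spectralSum, hf, Multiset.map_nsmul, Multiset.sum_nsmul]
  · symm
    rw [spectralSum, charpoly_mul_comm_of_le B A h,
      Polynomial.roots_mul (mul_ne_zero (pow_ne_zero _ Polynomial.X_ne_zero)
        (charpoly_monic (A * B)).ne_zero)]
    simp [spectralSum, hf, Multiset.map_nsmul, Multiset.sum_nsmul]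

theorem spectralSum_diagonal (f : ℝ → ℝ) (c : n → ℂ) :
    spectralSum f (diagonal c) = ∑ i, f (c i).re := by
  rw [spectralSum, charpoly_diagonal, Polynomial.roots_prod _ _
    (Finset.prod_ne_zero_iff.2 fun i _ => Polynomial.X_sub_C_ne_zero _)]
  simp

theorem spectralSum_conj (f : ℝ → ℝ) (U : unitaryGroup n ℂ) (H : Matrix n n ℂ) :
    spectralSum f ((U : Matrix n n ℂ) * H * star (U : Matrix n n ℂ)) = spectralSum f H := by
  rw [spectralSum_mul_comm, ← mul_assoc]
  simp

theorem spectralSum_eq_eigenvalues (f : ℝ → ℝ) {H : Matrix n n ℂ} (hH : H.IsHermitian) :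
    spectralSum f H = ∑ i, f (hH.eigenvalues i) := by
  rw [spectralSum, hH.roots_charpoly_eq_eigenvalues]
  simp

theorem eq_conj_diagonal {H : Matrix n n ℂ} (hH : H.IsHermitian) :
    H = (hH.eigenvectorUnitary : Matrix n n ℂ) * diagonal (fun i => (hH.eigenvalues i : ℂ)) *
      star (hH.eigenvectorUnitary : Matrix n n ℂ) := by
  conv_lhs => rw [hH.spectral_theorem, Unitary.conjStarAlgAut_apply]
  rfl

theorem conj_eigenvectorUnitary_apply {H : Matrix n n ℂ} (hH : H.IsHermitian) (i : n) :
    (star (hH.eigenvectorUnitary : Matrix n n ℂ) * H * hH.eigenvectorUnitary) i i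
      = (hH.eigenvalues i : ℂ) := by
  have h := eq_conj_diagonal hH
  have h2 : star (hH.eigenvectorUnitary : Matrix n n ℂ) * H * hH.eigenvectorUnitary =
      diagonal (fun i => (hH.eigenvalues i : ℂ)) := by
    rw [congrArg (fun K => star (hH.eigenvectorUnitary : Matrix n n ℂ) * K *
      hH.eigenvectorUnitary) h]
    simp only [mul_assoc]
    rw [Unitary.coe_star_mul_self, mul_one, ← mul_assoc, Unitary.coe_star_mul_self, one_mul]
  rw [h2, diagonal_apply_eq]

theorem spectralSum_cfc (f g : ℝ → ℝ) {H : Matrix n n ℂ} (hH : H.IsHermitian) :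
    spectralSum f (cfc g H) = spectralSum (f ∘ g) H := by
  rw [hH.cfc_eq, IsHermitian.cfc, Unitary.conjStarAlgAut_apply, spectralSum_conj,
    spectralSum_diagonal, spectralSum_eq_eigenvalues _ hH]
  simp

theorem trace_re_eq_spectralSum {H : Matrix n n ℂ} (hH : H.IsHermitian) :
    H.trace.re = spectralSum id H := by
  rw [hH.trace_eq_sum_eigenvalues, spectralSum_eq_eigenvalues _ hH]
  simp

theorem spectralSum_sq (f : ℝ → ℝ) {H : Matrix n n ℂ} (hH : H.IsHermitian) :
    spectralSum f (H * H) = spectralSum (fun x => f (x ^ 2)) H := by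
  have : H * H = cfc (fun x : ℝ => x ^ 2) H := by
    rw [cfc_pow_id (R := ℝ) H 2 (ha := hH.isSelfAdjoint), sq]
  rw [this, spectralSum_cfc _ _ hH]
  rfl

theorem spectralSum_smul (f : ℝ → ℝ) (t : ℝ) {H : Matrix n n ℂ} (hH : H.IsHermitian) :
    spectralSum f ((t : ℂ) • H) = spectralSum (fun x => f (t * x)) H := by
  have : (t : ℂ) • H = cfc (fun x : ℝ => t * x) H := by
    rw [cfc_const_mul_id (R := ℝ) t H (ha := hH.isSelfAdjoint)]
    ext i j
    simp
  rw [this, spectralSum_cfc _ _ hH]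
  rfl

theorem spectralSum_fromBlocks (f : ℝ → ℝ) (A : Matrix m m ℂ) (B : Matrix n n ℂ) :
    spectralSum f (fromBlocks A 0 0 B) = spectralSum f A + spectralSum f B := by
  rw [spectralSum, charpoly_fromBlocks_zero₁₂, Polynomial.roots_mul
    (mul_ne_zero (charpoly_monic A).ne_zero (charpoly_monic B).ne_zero)]
  simp [spectralSum]

/-- The diagonal of a Hermitian matrix in an orthonormal basis is a doubly stochastic average of
its eigenvalues. -/
theorem conj_diag_re_eq {H : Matrix n n ℂ} (hH : H.IsHermitian) (U : unitaryGroup n ℂ) (i : n) :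
    ((star (U : Matrix n n ℂ) * H * U) i i).re =
      ∑ j, ‖(star (U : Matrix n n ℂ) * hH.eigenvectorUnitary) i j‖ ^ 2 * hH.eigenvalues j := by
  set W : Matrix n n ℂ := star (U : Matrix n n ℂ) * hH.eigenvectorUnitary with hW
  have : star (U : Matrix n n ℂ) * H * U =
      W * diagonal (fun i => (hH.eigenvalues i : ℂ)) * star W := by
    rw [congrArg (fun K => star (U : Matrix n n ℂ) * K * U) (eq_conj_diagonal hH), hW, star_mul, star_star]
    simp only [mul_assoc]
  rw [this, mul_apply, Complex.re_sum]
  refine Finset.sum_congr rfl fun j _ => ?_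
  rw [mul_diagonal, star_apply, mul_right_comm, RCLike.star_def, Complex.mul_conj,
    Complex.normSq_eq_norm_sq, ← Complex.ofReal_mul, Complex.ofReal_re]

theorem sum_norm_sq_row (W : unitaryGroup n ℂ) (i : n) :
    ∑ j, ‖(W : Matrix n n ℂ) i j‖ ^ 2 = 1 := by
  have h := congrFun (congrFun (Unitary.coe_mul_star_self W) i) i
  rw [mul_apply] at h
  simp only [Unitary.coe_star, star_apply, RCLike.star_def, Complex.mul_conj,
    Complex.normSq_eq_norm_sq, one_apply_eq] at h
  exact_mod_cast h

theorem sum_norm_sq_col (W : unitaryGroup n ℂ) (j : n) :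
    ∑ i, ‖(W : Matrix n n ℂ) i j‖ ^ 2 = 1 := by
  rw [← sum_norm_sq_row (star W) j]
  refine Finset.sum_congr rfl fun i _ => ?_
  simp [star_apply]

/-- Jensen applied to each diagonal entry uses that the rows of `‖W i j‖²` sum to 1; summing over
the entries uses that the columns do. -/
theorem sum_conj_diag_le {f : ℝ → ℝ} {s : Set ℝ} (hf : ConvexOn ℝ s f) {H : Matrix n n ℂ}
    (hH : H.IsHermitian) (hs : ∀ i, hH.eigenvalues i ∈ s) (U : unitaryGroup n ℂ) :
    ∑ i, f ((star (U : Matrix n n ℂ) * H * U) i i).re ≤ spectralSum f H := by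
  set W : unitaryGroup n ℂ := star U * hH.eigenvectorUnitary
  have h1 : ∀ i, f ((star (U : Matrix n n ℂ) * H * U) i i).re ≤
      ∑ j, ‖(W : Matrix n n ℂ) i j‖ ^ 2 * f (hH.eigenvalues j) := by
    intro i
    rw [conj_diag_re_eq hH]
    exact hf.map_sum_le (fun _ _ => by positivity) (sum_norm_sq_row W i) fun j _ => hs j
  calc _ ≤ ∑ i, ∑ j, ‖(W : Matrix n n ℂ) i j‖ ^ 2 * f (hH.eigenvalues j) :=
        Finset.sum_le_sum fun i _ => h1 i
    _ = spectralSum f H := by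
        rw [Finset.sum_comm, spectralSum_eq_eigenvalues f hH]
        refine Finset.sum_congr rfl fun j _ => ?_
        rw [← Finset.sum_mul, sum_norm_sq_col, one_mul]

theorem le_sum_conj_diag {f : ℝ → ℝ} {s : Set ℝ} (hf : ConcaveOn ℝ s f) {H : Matrix n n ℂ}
    (hH : H.IsHermitian) (hs : ∀ i, hH.eigenvalues i ∈ s) (U : unitaryGroup n ℂ) :
    spectralSum f H ≤ ∑ i, f ((star (U : Matrix n n ℂ) * H * U) i i).re := by
  have h := sum_conj_diag_le hf.neg hH hs U
  have h2 : spectralSum (-f) H = - spectralSum f H := by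
    simp [spectralSum_eq_eigenvalues _ hH]
  rw [h2] at h
  simp only [Pi.neg_apply, Finset.sum_neg_distrib, neg_le_neg_iff] at h
  exact h

/-- The block diagonal matrix of the eigenbases of the diagonal blocks of `H`. -/
noncomputable def blockEigenbasis {H : Matrix (κ × n) (κ × n) ℂ}
    (hH : ∀ k, (H.submatrix (Prod.mk k) (Prod.mk k)).IsHermitian) : unitaryGroup (κ × n) ℂ :=
  ⟨of fun a b => if a.1 = b.1 then ((hH b.1).eigenvectorUnitary : Matrix n n ℂ) a.2 b.2 else 0, by
    rw [mem_unitaryGroup_iff']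
    ext ⟨k, i⟩ ⟨l, j⟩
    rw [mul_apply, Fintype.sum_prod_type]
    simp only [star_apply, of_apply]
    by_cases hkl : k = l
    · subst hkl
      have h := congrFun (congrFun (Unitary.coe_star_mul_self (hH k).eigenvectorUnitary) i) j
      rw [mul_apply] at h
      simp only [star_apply] at h
      rw [Finset.sum_eq_single k (fun b _ hb => by simp [hb]) (by simp)]
      simp only [if_true, h]
      simp [one_apply]
    · rw [one_apply_ne (by simp [hkl])]
      refine Finset.sum_eq_zero fun b _ => Finset.sum_eq_zero fun c _ => ?_
      by_cases hb : b = k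
      · rw [if_neg (c := b = l) (by rw [hb]; exact hkl), mul_zero]
      · rw [if_neg hb, star_zero, zero_mul]⟩

theorem conj_blockEigenbasis_apply {H : Matrix (κ × n) (κ × n) ℂ}
    (hH : ∀ k, (H.submatrix (Prod.mk k) (Prod.mk k)).IsHermitian) (k : κ) (i : n) :
    (star (blockEigenbasis hH : Matrix (κ × n) (κ × n) ℂ) * H * blockEigenbasis hH) (k, i) (k, i)
      = ((hH k).eigenvalues i : ℂ) := by
  rw [← conj_eigenvectorUnitary_apply (hH k)]
  simp only [mul_apply, Fintype.sum_prod_type, blockEigenbasis, star_apply, of_apply,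
    submatrix_apply]
  rw [Finset.sum_eq_single k (fun b _ hb => by simp [hb]) (by simp)]
  refine Finset.sum_congr rfl fun j _ => ?_
  rw [if_pos rfl]
  congr 1
  rw [Finset.sum_eq_single k (fun b _ hb => by simp [hb]) (by simp)]
  simp

/-- Pinching: in the basis `blockEigenbasis`, the diagonal of `H` consists of the eigenvalues of its
diagonal blocks, so the diagonal inequality applies. -/
theorem sum_spectralSum_block_le {f : ℝ → ℝ} {s : Set ℝ} (hf : ConvexOn ℝ s f)
    {H : Matrix (κ × n) (κ × n) ℂ} (hH : H.IsHermitian) (hs : ∀ i, hH.eigenvalues i ∈ s) :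
    ∑ k, spectralSum f (H.submatrix (Prod.mk k) (Prod.mk k)) ≤ spectralSum f H := by
  have hB : ∀ k : κ, (H.submatrix (Prod.mk k) (Prod.mk k)).IsHermitian := fun k => hH.submatrix _
  have h := sum_conj_diag_le hf hH hs (blockEigenbasis hB)
  rw [Fintype.sum_prod_type] at h
  simp only [conj_blockEigenbasis_apply, Complex.ofReal_re] at h
  simpa only [spectralSum_eq_eigenvalues f (hB _)] using h

theorem le_sum_spectralSum_block {f : ℝ → ℝ} {s : Set ℝ} (hf : ConcaveOn ℝ s f)
    {H : Matrix (κ × n) (κ × n) ℂ} (hH : H.IsHermitian) (hs : ∀ i, hH.eigenvalues i ∈ s) :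
    spectralSum f H ≤ ∑ k, spectralSum f (H.submatrix (Prod.mk k) (Prod.mk k)) := by
  have hB : ∀ k : κ, (H.submatrix (Prod.mk k) (Prod.mk k)).IsHermitian := fun k => hH.submatrix _
  have h := le_sum_conj_diag hf hH hs (blockEigenbasis hB)
  rw [Fintype.sum_prod_type] at h
  simp only [conj_blockEigenbasis_apply, Complex.ofReal_re] at h
  simpa only [spectralSum_eq_eigenvalues f (hB _)] using h

end SpectralSum

/-! ### Minkowski inequalities and block estimates for `Tr |A|^p`. -/

section Minkowski

variable {m n κ : Type*} [Fintype m] [DecidableEq m] [Fintype n] [DecidableEq n]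
  [Fintype κ] [DecidableEq κ]

theorem convexOn_abs_rpow {r : ℝ} (hr : 1 ≤ r) :
    ConvexOn ℝ Set.univ fun x : ℝ => |x| ^ r := by
  refine ⟨convex_univ, fun x _ y _ a b ha hb hab => ?_⟩
  have h := (convexOn_rpow hr).2 (abs_nonneg x) (abs_nonneg y) ha hb hab
  refine le_trans (Real.rpow_le_rpow (abs_nonneg _) ?_ (by linarith)) h
  refine (abs_add_le _ _).trans ?_
  simp [abs_mul, abs_of_nonneg ha, abs_of_nonneg hb]

theorem concaveOn_abs_rpow {r : ℝ} (hr : 0 ≤ r) (hr1 : r ≤ 1) :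
    ConcaveOn ℝ (Set.Ici 0) fun x : ℝ => |x| ^ r :=
  (Real.concaveOn_rpow hr hr1).congr fun x hx => by
    simp only [abs_of_nonneg (Set.mem_Ici.1 hx)]

/-- Minkowski's inequality for a finite family of real vectors. -/
theorem rpow_sum_abs_sum_le {ι : Type*} {j : Type*} [Fintype ι] [Fintype j] {s : ℝ} (hs : 1 ≤ s)
    (x : j → ι → ℝ) :
    (∑ i, |∑ k, x k i| ^ s) ^ (1 / s) ≤ ∑ k, (∑ i, |x k i| ^ s) ^ (1 / s) := by
  have hs0 : 0 < s := by linarith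
  have : Fact (1 ≤ ENNReal.ofReal s) := ⟨by simpa using hs⟩
  have hr : (ENNReal.ofReal s).toReal = s := ENNReal.toReal_ofReal hs0.le
  have h := norm_sum_le Finset.univ fun k => WithLp.toLp (ENNReal.ofReal s) (x k)
  simp only [PiLp.norm_eq_sum (p := ENNReal.ofReal s) (by rw [hr]; exact hs0), hr] at h
  simpa using h

theorem spectralSum_abs_nonneg {r : ℝ} {H : Matrix n n ℂ} :
    0 ≤ spectralSum (fun x => |x| ^ r) H := by
  refine Multiset.sum_nonneg fun x hx => ?_
  obtain ⟨z, -, rfl⟩ := Multiset.mem_map.1 hx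
  positivity

omit [DecidableEq κ] in
-- In an eigenbasis of the sum, its eigenvalues are the sums of the diagonals of the `H k`.
-- Minkowski in `ℓ^r` separates the summands, and Jensen bounds each diagonal by the spectrum of `H
-- k`.
theorem rpow_spectralSum_sum_le {r : ℝ} (hr : 1 ≤ r) (H : κ → Matrix n n ℂ)
    (hH : ∀ k, (H k).IsHermitian) :
    spectralSum (fun x => |x| ^ r) (∑ k, H k) ^ (1 / r) ≤
      ∑ k, spectralSum (fun x => |x| ^ r) (H k) ^ (1 / r) := by
  have hS : (∑ k, H k).IsHermitian := by
    rw [IsHermitian, conjTranspose_sum]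
    exact Finset.sum_congr rfl fun k _ => hH k
  set U := hS.eigenvectorUnitary
  have hr0 : (0 : ℝ) ≤ 1 / r := by positivity
  have key : ∀ i, hS.eigenvalues i =
      ∑ k, ((star (U : Matrix n n ℂ) * H k * U) i i).re := by
    intro i
    rw [← Complex.ofReal_re (hS.eigenvalues i), ← conj_eigenvectorUnitary_apply hS i,
      Finset.mul_sum, Finset.sum_mul, Matrix.sum_apply, Complex.re_sum]
  rw [spectralSum_eq_eigenvalues _ hS]
  simp only [key]
  refine (rpow_sum_abs_sum_le hr _).trans (Finset.sum_le_sum fun k _ => ?_)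
  exact Real.rpow_le_rpow (Finset.sum_nonneg fun _ _ => by positivity)
    (sum_conj_diag_le (convexOn_abs_rpow hr) (hH k) (fun _ => Set.mem_univ _) U) hr0

omit [DecidableEq κ] in
-- Reverse Minkowski for `r ≤ 1`. Positivity makes the diagonals in the eigenbasis of the sum
-- nonnegative, and concavity reverses the Jensen step.
theorem sum_rpow_spectralSum_le {r : ℝ} (hr : 0 < r) (hr1 : r ≤ 1) (H : κ → Matrix n n ℂ)
    (hH : ∀ k, (H k).PosSemidef) :
    ∑ k, spectralSum (fun x => |x| ^ r) (H k) ^ (1 / r) ≤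
      spectralSum (fun x => |x| ^ r) (∑ k, H k) ^ (1 / r) := by
  have hS : (∑ k, H k).IsHermitian := by
    rw [IsHermitian, conjTranspose_sum]
    exact Finset.sum_congr rfl fun k _ => (hH k).1
  set U := hS.eigenvectorUnitary
  have hr0 : (0 : ℝ) ≤ 1 / r := by positivity
  have hs : 1 ≤ 1 / r := by rw [le_div_iff₀ hr]; linarith
  set a : n → κ → ℝ := fun i k => ((star (U : Matrix n n ℂ) * H k * U) i i).re with ha
  have ha0 : ∀ i k, 0 ≤ a i k := by
    intro i k
    have h : (star (U : Matrix n n ℂ) * H k * U).PosSemidef :=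
      (hH k).conjTranspose_mul_mul_same _
    exact (Complex.nonneg_iff.1 h.diag_nonneg).1
  have key : ∀ i, hS.eigenvalues i = ∑ k, a i k := by
    intro i
    rw [← Complex.ofReal_re (hS.eigenvalues i), ← conj_eigenvectorUnitary_apply hS i,
      Finset.mul_sum, Finset.sum_mul, Matrix.sum_apply, Complex.re_sum]
  have h1 : ∀ k, spectralSum (fun x => |x| ^ r) (H k) ≤ ∑ i, |a i k| ^ r := fun k =>
    le_sum_conj_diag (concaveOn_abs_rpow hr.le hr1) (hH k).1
      (fun i => (hH k).eigenvalues_nonneg i) U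
  -- Ordinary Minkowski at exponent `1 / r ≥ 1`, with the roles exchanged: the vectors are indexed
  -- by `k` and summed over `i`.
  have hM := rpow_sum_abs_sum_le hs fun i k => |a i k| ^ r
  have hsimp : ∀ i k, |(|a i k| ^ r)| ^ (1 / r) = a i k := by
    intro i k
    rw [abs_of_nonneg (a := |a i k| ^ r) (by positivity), one_div,
      Real.rpow_rpow_inv (abs_nonneg _) hr.ne', abs_of_nonneg (ha0 i k)]
  simp only [hsimp, one_div_one_div] at hM
  rw [spectralSum_eq_eigenvalues _ hS]
  simp only [key, abs_of_nonneg (Finset.sum_nonneg fun k _ => ha0 _ k)]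
  have hpos : (0 : ℝ) ≤ ∑ k, spectralSum (fun x => |x| ^ r) (H k) ^ (1 / r) :=
    Finset.sum_nonneg fun k _ => Real.rpow_nonneg spectralSum_abs_nonneg _
  have h2 : ∑ k, spectralSum (fun x => |x| ^ r) (H k) ^ (1 / r) ≤
      ∑ k, |∑ i, |a i k| ^ r| ^ (1 / r) :=
    Finset.sum_le_sum fun k _ => Real.rpow_le_rpow spectralSum_abs_nonneg
      ((h1 k).trans (le_abs_self _)) hr0
  have h3 := (Real.rpow_le_rpow hpos h2 hr.le).trans hM
  have h4 := Real.rpow_le_rpow (Real.rpow_nonneg hpos _) h3 hr0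
  rwa [← Real.rpow_mul hpos, mul_one_div_cancel hr.ne', Real.rpow_one] at h4

/-- `Tr |A|^p` for a rectangular matrix `A`. -/
noncomputable def schattenPow (p : ℝ) (A : Matrix m n ℂ) : ℝ :=
  spectralSum (fun x => |x| ^ (p / 2)) (A * Aᴴ)

omit [DecidableEq n] in
theorem schattenPow_nonneg (p : ℝ) (A : Matrix m n ℂ) : 0 ≤ schattenPow p A :=
  spectralSum_abs_nonneg

theorem schattenPow_conjTranspose {p : ℝ} (hp : 0 < p) (A : Matrix m n ℂ) :
    schattenPow p Aᴴ = schattenPow p A := by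
  rw [schattenPow, schattenPow, conjTranspose_conjTranspose]
  exact spectralSum_mul_comm_rect (by rw [abs_zero, Real.zero_rpow (by positivity)]) _ _

omit [Fintype m] [DecidableEq m] [DecidableEq n] [DecidableEq κ] in
theorem mul_conjTranspose_eq_sum_columns (A : Matrix m (κ × n) ℂ) :
    A * Aᴴ = ∑ k, A.submatrix id (Prod.mk k) * (A.submatrix id (Prod.mk k))ᴴ := by
  ext i j
  simp [mul_apply, Matrix.sum_apply, Fintype.sum_prod_type]

omit [DecidableEq n] [DecidableEq κ] in
-- `A A*` is the sum of the same products for the column strips, and `p / 2 ≥ 1`.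
theorem schattenPow_le_sum_columns {p : ℝ} (hp : 2 ≤ p) (A : Matrix m (κ × n) ℂ) :
    schattenPow p A ^ (2 / p) ≤ ∑ k : κ, schattenPow p (A.submatrix id (Prod.mk k)) ^ (2 / p) := by
  have h := rpow_spectralSum_sum_le (r := p / 2) (by linarith)
    (fun k : κ => A.submatrix id (Prod.mk k) * (A.submatrix id (Prod.mk k))ᴴ)
    fun k => isHermitian_mul_conjTranspose_self _
  rw [← mul_conjTranspose_eq_sum_columns, one_div_div] at h
  exact h

omit [DecidableEq n] [DecidableEq κ] in
theorem sum_columns_le_schattenPow {p : ℝ} (hp0 : 0 < p) (hp : p ≤ 2) (A : Matrix m (κ × n) ℂ) :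
    ∑ k : κ, schattenPow p (A.submatrix id (Prod.mk k)) ^ (2 / p) ≤ schattenPow p A ^ (2 / p) := by
  have h := sum_rpow_spectralSum_le (r := p / 2) (by linarith) (by linarith)
    (fun k : κ => A.submatrix id (Prod.mk k) * (A.submatrix id (Prod.mk k))ᴴ)
    fun k => posSemidef_self_mul_conjTranspose _
  rw [← mul_conjTranspose_eq_sum_columns, one_div_div] at h
  exact h

omit [DecidableEq m] [Fintype n] [DecidableEq n] [Fintype κ] [DecidableEq κ] in
theorem submatrix_conjTranspose_mul_self (A : Matrix m (κ × n) ℂ) (k : κ) :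
    (Aᴴ * A).submatrix (Prod.mk k) (Prod.mk k) =
      (A.submatrix id (Prod.mk k))ᴴ * (A.submatrix id (Prod.mk k)) := by
  ext i j
  simp [mul_apply]

theorem schattenPow_eq_spectralSum_conjTranspose_mul {p : ℝ} (hp : 0 < p) (A : Matrix m n ℂ) :
    schattenPow p A = spectralSum (fun x => |x| ^ (p / 2)) (Aᴴ * A) := by
  rw [← schattenPow_conjTranspose hp, schattenPow, conjTranspose_conjTranspose]

/-- The diagonal blocks of `A* A` are the Gram matrices of the column strips, so this is pinching
for the convex function `|x|^(p/2)`. -/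
theorem sum_columns_schattenPow_le {p : ℝ} (hp : 2 ≤ p) (A : Matrix m (κ × n) ℂ) :
    ∑ k : κ, schattenPow p (A.submatrix id (Prod.mk k)) ≤ schattenPow p A := by
  simp only [schattenPow_eq_spectralSum_conjTranspose_mul (show 0 < p by linarith),
    ← submatrix_conjTranspose_mul_self]
  exact sum_spectralSum_block_le (convexOn_abs_rpow (by linarith))
    (isHermitian_conjTranspose_mul_self A) fun _ => Set.mem_univ _

theorem schattenPow_le_sum_columns_schattenPow {p : ℝ} (hp0 : 0 < p) (hp : p ≤ 2)
    (A : Matrix m (κ × n) ℂ) :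
    schattenPow p A ≤ ∑ k : κ, schattenPow p (A.submatrix id (Prod.mk k)) := by
  simp only [schattenPow_eq_spectralSum_conjTranspose_mul hp0,
    ← submatrix_conjTranspose_mul_self]
  exact le_sum_spectralSum_block (concaveOn_abs_rpow (by linarith) (by linarith))
    (isHermitian_conjTranspose_mul_self A)
    fun i => (posSemidef_conjTranspose_mul_self A).eigenvalues_nonneg i

/-- The block at position `(k, l)` of a matrix indexed by pairs. -/
abbrev block (A : Matrix (κ × n) (κ × n) ℂ) (k l : κ) : Matrix n n ℂ :=
  A.submatrix (Prod.mk k) (Prod.mk l)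

omit [Fintype κ] [DecidableEq κ] in
theorem schattenPow_block {p : ℝ} (hp : 0 < p) (A : Matrix (κ × n) (κ × n) ℂ) (k l : κ) :
    schattenPow p (((A.submatrix id (Prod.mk l))ᴴ).submatrix id (Prod.mk k)) =
      schattenPow p (block A k l) :=
  schattenPow_conjTranspose hp (block A k l)

/-- The column estimate is used twice: on `A`, then on the adjoint of each column strip, whose own
strips are the adjoints of the blocks. -/
theorem schattenPow_le_sum_blocks {p : ℝ} (hp : 2 ≤ p) (A : Matrix (κ × n) (κ × n) ℂ) :
    schattenPow p A ^ (2 / p) ≤ ∑ l : κ, ∑ k : κ, schattenPow p (block A k l) ^ (2 / p) := by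
  have hp0 : 0 < p := by linarith
  refine (schattenPow_le_sum_columns hp A).trans (Finset.sum_le_sum fun l _ => ?_)
  rw [← schattenPow_conjTranspose hp0]
  simpa only [schattenPow_block hp0] using
    schattenPow_le_sum_columns hp ((A.submatrix id (Prod.mk l))ᴴ)

theorem sum_blocks_le_schattenPow {p : ℝ} (hp0 : 0 < p) (hp : p ≤ 2)
    (A : Matrix (κ × n) (κ × n) ℂ) :
    ∑ l : κ, ∑ k : κ, schattenPow p (block A k l) ^ (2 / p) ≤ schattenPow p A ^ (2 / p) := by
  refine le_trans (Finset.sum_le_sum fun l _ => ?_) (sum_columns_le_schattenPow hp0 hp A)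
  rw [← schattenPow_conjTranspose hp0 (A.submatrix id (Prod.mk l))]
  simpa only [schattenPow_block hp0] using
    sum_columns_le_schattenPow hp0 hp ((A.submatrix id (Prod.mk l))ᴴ)

theorem sum_blocks_schattenPow_le {p : ℝ} (hp : 2 ≤ p) (A : Matrix (κ × n) (κ × n) ℂ) :
    ∑ l : κ, ∑ k : κ, schattenPow p (block A k l) ≤ schattenPow p A := by
  have hp0 : 0 < p := by linarith
  refine le_trans (Finset.sum_le_sum fun l _ => ?_) (sum_columns_schattenPow_le hp A)
  rw [← schattenPow_conjTranspose hp0 (A.submatrix id (Prod.mk l))]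
  simpa only [schattenPow_block hp0] using
    sum_columns_schattenPow_le hp ((A.submatrix id (Prod.mk l))ᴴ)

theorem schattenPow_le_sum_blocks_schattenPow {p : ℝ} (hp0 : 0 < p) (hp : p ≤ 2)
    (A : Matrix (κ × n) (κ × n) ℂ) :
    schattenPow p A ≤ ∑ l : κ, ∑ k : κ, schattenPow p (block A k l) := by
  refine (schattenPow_le_sum_columns_schattenPow hp0 hp A).trans
    (Finset.sum_le_sum fun l _ => ?_)
  rw [← schattenPow_conjTranspose hp0 (A.submatrix id (Prod.mk l))]
  simpa only [schattenPow_block hp0] using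
    schattenPow_le_sum_columns_schattenPow hp0 hp ((A.submatrix id (Prod.mk l))ᴴ)

end Minkowski

/-! ### Schatten norms: basic properties, triangle inequality, comparison with blocks. -/

section SchattenNorm

variable {n κ : Type*} [Fintype n] [DecidableEq n] [Fintype κ] [DecidableEq κ]

theorem schattenNorm_eq {p : ℝ} (hp : 0 < p) (A : Matrix n n ℂ) :
    schattenNorm p A = schattenPow p A ^ (1 / p) := by
  have h0 : 0 ≤ A * Aᴴ := (posSemidef_self_mul_conjTranspose A).nonneg
  have h1 : CFC.sqrt (A * Aᴴ) ^ p = (A * Aᴴ) ^ (p / 2) :=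
    CFC.rpow_sqrt_nnreal (x := ⟨p, hp.le⟩) h0
  have h2 : ((A * Aᴴ) ^ (p / 2)).trace.re = schattenPow p A := by
    have hH : (A * Aᴴ).IsHermitian := isHermitian_mul_conjTranspose_self A
    have hc : (cfc (fun x : ℝ => x ^ (p / 2)) (A * Aᴴ)).IsHermitian :=
      (cfc_predicate _ _ : IsSelfAdjoint _)
    rw [CFC.rpow_eq_cfc_real h0, trace_re_eq_spectralSum hc, spectralSum_cfc _ _ hH, schattenPow,
      spectralSum_eq_eigenvalues _ hH, spectralSum_eq_eigenvalues _ hH]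
    refine Finset.sum_congr rfl fun i _ => ?_
    rw [abs_of_nonneg ((posSemidef_self_mul_conjTranspose A).eigenvalues_nonneg i)]
    rfl
  rw [schattenNorm, h1, h2]

theorem schattenNorm_nonneg {p : ℝ} (hp : 0 < p) (A : Matrix n n ℂ) : 0 ≤ schattenNorm p A := by
  rw [schattenNorm_eq hp]
  exact Real.rpow_nonneg (schattenPow_nonneg p A) _

theorem schattenNorm_sq {p : ℝ} (hp : 0 < p) (A : Matrix n n ℂ) :
    schattenNorm p A ^ 2 = schattenPow p A ^ (2 / p) := by
  rw [schattenNorm_eq hp, ← Real.rpow_mul_natCast (schattenPow_nonneg p A)]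
  congr 1
  push_cast
  ring

theorem eq_zero_of_schattenNorm_eq_zero {p : ℝ} (hp : 0 < p) {A : Matrix n n ℂ}
    (h : schattenNorm p A = 0) : A = 0 := by
  have hH : (A * Aᴴ).IsHermitian := isHermitian_mul_conjTranspose_self A
  rw [schattenNorm_eq hp, Real.rpow_eq_zero (schattenPow_nonneg p A) (by positivity), schattenPow,
    spectralSum_eq_eigenvalues _ hH, Finset.sum_eq_zero_iff_of_nonneg fun _ _ => by positivity] at h
  have h' : hH.eigenvalues = 0 := by
    funext i
    have := h i (Finset.mem_univ i)
    rwa [Real.rpow_eq_zero (abs_nonneg _) (by positivity), abs_eq_zero] at this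
  exact self_mul_conjTranspose_eq_zero.1 (hH.eigenvalues_eq_zero_iff.1 h')

theorem schattenNorm_zero {p : ℝ} (hp : 0 < p) : schattenNorm p (0 : Matrix n n ℂ) = 0 := by
  rw [schattenNorm_eq hp, schattenPow, zero_mul, ← diagonal_zero, spectralSum_diagonal]
  simp [hp.ne']

theorem schattenNorm_smul {p : ℝ} (hp : 0 < p) (c : ℂ) (A : Matrix n n ℂ) :
    schattenNorm p (c • A) = ‖c‖ * schattenNorm p A := by
  have h1 : (c • A) * (c • A)ᴴ = ((‖c‖ ^ 2 : ℝ) : ℂ) • (A * Aᴴ) := by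
    rw [conjTranspose_smul, smul_mul_smul_comm, RCLike.star_def, Complex.mul_conj,
      Complex.normSq_eq_norm_sq]
  have h2 : schattenPow p (c • A) = ‖c‖ ^ p * schattenPow p A := by
    have h3 : ∀ x : ℝ, |‖c‖ ^ 2 * x| ^ (p / 2) = ‖c‖ ^ p * |x| ^ (p / 2) := by
      intro x
      rw [abs_mul, Real.mul_rpow (abs_nonneg _) (abs_nonneg _), abs_of_nonneg (by positivity),
        ← Real.rpow_natCast_mul (norm_nonneg c)]
      congr 2
      push_cast
      ring
    have hH : (A * Aᴴ).IsHermitian := isHermitian_mul_conjTranspose_self A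
    rw [schattenPow, h1, spectralSum_smul _ _ hH, schattenPow,
      spectralSum_eq_eigenvalues _ hH, spectralSum_eq_eigenvalues _ hH, Finset.mul_sum]
    exact Finset.sum_congr rfl fun i _ => h3 _
  rw [schattenNorm_eq hp, schattenNorm_eq hp, h2,
    Real.mul_rpow (by positivity) (schattenPow_nonneg p A), ← Real.rpow_mul (norm_nonneg c),
    mul_one_div_cancel hp.ne', Real.rpow_one]

theorem schattenNorm_two_sq (A : Matrix n n ℂ) :
    schattenNorm 2 A ^ 2 = ∑ i, ∑ j, ‖A i j‖ ^ 2 := by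
  have hH : (A * Aᴴ).IsHermitian := isHermitian_mul_conjTranspose_self A
  have h : schattenPow 2 A = (A * Aᴴ).trace.re := by
    rw [trace_re_eq_spectralSum hH, schattenPow, spectralSum_eq_eigenvalues _ hH,
      spectralSum_eq_eigenvalues _ hH]
    refine Finset.sum_congr rfl fun i _ => ?_
    rw [abs_of_nonneg ((posSemidef_self_mul_conjTranspose A).eigenvalues_nonneg i), div_self
      two_ne_zero, Real.rpow_one, id]
  rw [schattenNorm_sq two_pos, div_self two_ne_zero, Real.rpow_one, h, trace, Complex.re_sum]
  refine Finset.sum_congr rfl fun i _ => ?_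
  rw [diag_apply, mul_apply, Complex.re_sum]
  refine Finset.sum_congr rfl fun j _ => ?_
  rw [conjTranspose_apply, RCLike.star_def, Complex.mul_conj, Complex.normSq_eq_norm_sq,
    Complex.ofReal_re]

/-- An entry is at most the norm of its row, whose square is a diagonal entry of `A A*`, hence an
average of eigenvalues that are each at most `‖A‖_p²`. -/
theorem norm_apply_le_schattenNorm {p : ℝ} (hp : 0 < p) (A : Matrix n n ℂ) (i j : n) :
    ‖A i j‖ ≤ schattenNorm p A := by
  have hP : (A * Aᴴ).PosSemidef := posSemidef_self_mul_conjTranspose A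
  have hev : ∀ k, hP.1.eigenvalues k ≤ schattenNorm p A ^ 2 := by
    intro k
    have h0 := hP.eigenvalues_nonneg k
    have h1 : |hP.1.eigenvalues k| ^ (p / 2) ≤ schattenPow p A := by
      rw [schattenPow, spectralSum_eq_eigenvalues _ hP.1]
      exact Finset.single_le_sum (f := fun k => |hP.1.eigenvalues k| ^ (p / 2))
        (fun _ _ => by positivity) (Finset.mem_univ k)
    have h2 := Real.rpow_le_rpow (by positivity) h1 (show 0 ≤ (p / 2)⁻¹ by positivity)
    rwa [Real.rpow_rpow_inv (abs_nonneg _) (by positivity), abs_of_nonneg h0, inv_div,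
      ← schattenNorm_sq hp] at h2
  have hdiag : ((A * Aᴴ) i i).re ≤ schattenNorm p A ^ 2 := by
    have h := conj_diag_re_eq hP.1 1 i
    rw [OneMemClass.coe_one, star_one, one_mul, mul_one] at h
    rw [h, one_mul]
    calc _ ≤ ∑ k, ‖(hP.1.eigenvectorUnitary : Matrix n n ℂ) i k‖ ^ 2 * schattenNorm p A ^ 2 :=
          Finset.sum_le_sum fun k _ => mul_le_mul_of_nonneg_left (hev k) (by positivity)
      _ = _ := by rw [← Finset.sum_mul, sum_norm_sq_row, one_mul]
  have hrow : ((A * Aᴴ) i i).re = ∑ k, ‖A i k‖ ^ 2 := by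
    rw [mul_apply, Complex.re_sum]
    refine Finset.sum_congr rfl fun k _ => ?_
    rw [conjTranspose_apply, RCLike.star_def, Complex.mul_conj, Complex.normSq_eq_norm_sq,
      Complex.ofReal_re]
  refine le_of_sq_le_sq (le_trans ?_ (hrow ▸ hdiag)) (schattenNorm_nonneg hp A)
  exact Finset.single_le_sum (f := fun k => ‖A i k‖ ^ 2) (fun _ _ => by positivity)
    (Finset.mem_univ j)

/-- The Hermitian dilation of a matrix. -/
def dilation (A : Matrix n n ℂ) : Matrix (n ⊕ n) (n ⊕ n) ℂ := fromBlocks 0 A Aᴴ 0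

omit [Fintype n] [DecidableEq n] in
theorem isHermitian_dilation (A : Matrix n n ℂ) : (dilation A).IsHermitian := by
  simp [dilation, IsHermitian, fromBlocks_conjTranspose]

omit [Fintype n] [DecidableEq n] [DecidableEq κ] in
theorem dilation_sum (A : κ → Matrix n n ℂ) : dilation (∑ k, A k) = ∑ k, dilation (A k) := by
  ext (i | i) (j | j) <;> simp [dilation, Matrix.sum_apply]

/-- The square of the dilation is block diagonal with blocks `A A*` and `A* A`, each contributing
`Tr |A|^p`. -/
theorem spectralSum_dilation {p : ℝ} (hp : 0 < p) (A : Matrix n n ℂ) :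
    spectralSum (fun x => |x| ^ p) (dilation A) = 2 * schattenPow p A := by
  have h1 : (fun x : ℝ => |x| ^ p) = fun x => |x ^ 2| ^ (p / 2) := by
    funext x
    rw [abs_pow, ← Real.rpow_natCast_mul (abs_nonneg x)]
    congr 1
    push_cast
    ring
  rw [h1, ← spectralSum_sq (fun x => |x| ^ (p / 2)) (isHermitian_dilation A), dilation,
    fromBlocks_multiply]
  simp only [zero_mul, mul_zero, zero_add, add_zero]
  rw [spectralSum_fromBlocks, ← schattenPow_eq_spectralSum_conjTranspose_mul hp, ← schattenPow,
    two_mul]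

omit [DecidableEq κ] in
-- The dilation is additive and Hermitian, so the Hermitian Minkowski inequality applies; the common
-- factor `2^(1/p)` cancels.
theorem schattenNorm_sum_le {p : ℝ} (hp : 1 ≤ p) (A : κ → Matrix n n ℂ) :
    schattenNorm p (∑ k, A k) ≤ ∑ k, schattenNorm p (A k) := by
  have hp0 : 0 < p := by linarith
  have h := rpow_spectralSum_sum_le hp (fun k => dilation (A k)) fun k => isHermitian_dilation _
  rw [← dilation_sum] at h
  simp only [spectralSum_dilation hp0, Real.mul_rpow two_pos.le (schattenPow_nonneg p _),
    ← schattenNorm_eq hp0, ← Finset.mul_sum] at h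
  exact le_of_mul_le_mul_left h (by positivity)

theorem schattenNorm_sq_le_sum_blocks {p : ℝ} (hp : 2 ≤ p) (A : Matrix (κ × n) (κ × n) ℂ) :
    schattenNorm p A ^ 2 ≤ ∑ l : κ, ∑ k : κ, schattenNorm p (block A k l) ^ 2 := by
  have hp0 : 0 < p := by linarith
  simpa only [schattenNorm_sq hp0] using schattenPow_le_sum_blocks hp A

theorem sum_blocks_le_schattenNorm_sq {p : ℝ} (hp0 : 0 < p) (hp : p ≤ 2)
    (A : Matrix (κ × n) (κ × n) ℂ) :
    ∑ l : κ, ∑ k : κ, schattenNorm p (block A k l) ^ 2 ≤ schattenNorm p A ^ 2 := by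
  simpa only [schattenNorm_sq hp0] using sum_blocks_le_schattenPow hp0 hp A

omit [DecidableEq κ] in
theorem card_rpow_sq (r : ℝ) :
    ((Fintype.card (κ × κ) : ℕ) : ℝ) ^ r = ((Fintype.card κ : ℝ) ^ r) ^ 2 := by
  rw [Fintype.card_prod, Nat.cast_mul, Real.mul_rpow (by positivity) (by positivity), sq]

theorem sum_blocks_le_card_mul_schattenNorm_sq {p : ℝ} (hp : 2 ≤ p)
    (A : Matrix (κ × n) (κ × n) ℂ) :
    ∑ l : κ, ∑ k : κ, schattenNorm p (block A k l) ^ 2 ≤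
      ((Fintype.card κ : ℝ) ^ (1 - 2 / p)) ^ 2 * schattenNorm p A ^ 2 := by
  have hp0 : 0 < p := by linarith
  have hinv : 2 / p = (p / 2)⁻¹ := (inv_div p 2).symm
  have h1 := sum_blocks_schattenPow_le hp A
  simp only [schattenNorm_sq hp0]
  rw [← Fintype.sum_prod_type'] at h1 ⊢
  -- Power mean at exponent `p / 2` over all blocks. Their number is the square of `card κ`, which
  -- gives the squared constant once the `p / 2`-th root is taken.
  have h2 := Real.rpow_sum_le_const_mul_sum_rpow_of_nonneg (Finset.univ : Finset (κ × κ))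
    (f := fun x => schattenPow p (block A x.2 x.1) ^ (2 / p)) (p := p / 2) (by linarith)
    fun x _ => Real.rpow_nonneg (schattenPow_nonneg _ _) _
  simp only [hinv, Real.rpow_inv_rpow (schattenPow_nonneg _ _) (show p / 2 ≠ 0 by positivity)]
    at h2 ⊢
  set T := ∑ x : κ × κ, schattenPow p (block A x.2 x.1) ^ (p / 2)⁻¹ with hT
  have hT0 : 0 ≤ T := Finset.sum_nonneg fun _ _ => Real.rpow_nonneg (schattenPow_nonneg _ _) _
  have h3 := h2.trans (mul_le_mul_of_nonneg_left h1 (by positivity))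
  have h4 := Real.rpow_le_rpow (by positivity) h3 (show 0 ≤ (p / 2)⁻¹ by positivity)
  rw [Real.rpow_rpow_inv hT0 (by positivity), Real.mul_rpow (by positivity)
    (schattenPow_nonneg _ _), ← Real.rpow_mul (by positivity), Finset.card_univ] at h4
  rw [← card_rpow_sq]
  convert h4 using 3
  field_simp

theorem schattenNorm_sq_le_card_mul_sum_blocks {p : ℝ} (hp0 : 0 < p) (hp : p ≤ 2)
    (A : Matrix (κ × n) (κ × n) ℂ) :
    schattenNorm p A ^ 2 ≤ ((Fintype.card κ : ℝ) ^ (2 / p - 1)) ^ 2 *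
      ∑ l : κ, ∑ k : κ, schattenNorm p (block A k l) ^ 2 := by
  have h1 := schattenPow_le_sum_blocks_schattenPow hp0 hp A
  simp only [schattenNorm_sq hp0]
  rw [← Fintype.sum_prod_type'] at h1 ⊢
  have h2 := Real.rpow_sum_le_const_mul_sum_rpow_of_nonneg (Finset.univ : Finset (κ × κ))
    (f := fun x => schattenPow p (block A x.2 x.1)) (p := 2 / p)
    (by rw [le_div_iff₀ hp0]; linarith) fun x _ => schattenPow_nonneg _ _
  rw [Finset.card_univ, card_rpow_sq] at h2
  exact (Real.rpow_le_rpow (schattenPow_nonneg _ _) h1 (by positivity)).trans h2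

end SchattenNorm

/-! ### The block formula for `Φ ⊗ Ω` and the resulting bound. -/

section Bound

variable {ι κ ν μ : Type*} [Fintype ι] [DecidableEq ι] [Fintype κ] [DecidableEq κ]
  [Fintype ν] [DecidableEq ν] [Fintype μ] [DecidableEq μ]

omit [Fintype ν] [DecidableEq ν] in
theorem eq_sum_single_kronecker_block (A : Matrix (ι × ν) (ι × ν) ℂ) :
    A = ∑ x : ι × ι, single x.1 x.2 (1 : ℂ) ⊗ₖ block A x.1 x.2 := by
  ext ⟨i, a⟩ ⟨j, b⟩
  rw [Matrix.sum_apply, Finset.sum_eq_single (i, j)]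
  · simp
  · rintro ⟨i', j'⟩ - h
    rw [kronecker_apply, single_apply_of_ne, zero_mul]
    rintro ⟨rfl, rfl⟩
    exact h rfl
  · simp

/-- Expanding the input in matrix units gives `∑ Φ(E i j) ⊗ Ω(A i j)`; linearity of `Ω` moves the
scalar entries of `Φ(E i j)` inside. -/
theorem block_tensorMap (Φ : Superoperator ι κ) (Ω : Superoperator ν μ)
    (A : Matrix (ι × ν) (ι × ν) ℂ) (k l : κ) :
    block (tensorMap Φ Ω A) k l =
      Ω (∑ x : ι × ι, Φ (single x.1 x.2 1) k l • block A x.1 x.2) := by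
  have h : tensorMap Φ Ω A = ∑ x : ι × ι, Φ (single x.1 x.2 1) ⊗ₖ Ω (block A x.1 x.2) := by
    conv_lhs => rw [eq_sum_single_kronecker_block A]
    simp only [map_sum, tensorMap_kronecker]
  rw [h, map_sum]
  ext a b
  simp [Matrix.sum_apply]

omit [Fintype κ] [DecidableEq κ] in
theorem choiMatrix_apply (Φ : Superoperator ι κ) (i j : ι) (k l : κ) :
    choiMatrix Φ (i, k) (j, l) = Φ (single i j 1) k l := by
  rw [choiMatrix, Matrix.sum_apply, Finset.sum_eq_single i _ (by simp), Matrix.sum_apply,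
    Finset.sum_eq_single j _ (by simp)]
  · simp
  · intro b _ hb
    simp [hb]
  · intro b _ hb
    rw [Matrix.sum_apply]
    exact Finset.sum_eq_zero fun c _ => by simp [hb]

theorem schattenNorm_two_choiMatrix_sq (Φ : Superoperator ι κ) :
    schattenNorm 2 (choiMatrix Φ) ^ 2 =
      ∑ l, ∑ k, ∑ x : ι × ι, ‖Φ (single x.1 x.2 1) k l‖ ^ 2 := by
  rw [schattenNorm_two_sq]
  simp only [Fintype.sum_prod_type, choiMatrix_apply]
  rw [Finset.sum_comm]
  conv_rhs => rw [Finset.sum_comm]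
  exact Finset.sum_congr rfl fun k _ =>
    (Finset.sum_congr rfl fun i _ => Finset.sum_comm).trans Finset.sum_comm

/-- Expanding `A` in matrix units bounds the quotient independently of `A`. Finiteness lets the
later estimates use the real value of the supremum. -/
theorem outputPurity_ne_top {q p : ℝ} (hq : 0 < q) (hp : 1 ≤ p) (Ω : Superoperator ν μ) :
    outputPurity q p Ω ≠ ⊤ := by
  have hp0 : 0 < p := by linarith
  refine ne_top_of_le_ne_top (b := ENNReal.ofReal
    (∑ x : ν × ν, schattenNorm p (Ω (single x.1 x.2 1)))) ENNReal.ofReal_ne_top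
    (iSup₂_le fun A hA => ENNReal.ofReal_le_ofReal ?_)
  have hpos : 0 < schattenNorm q A :=
    (schattenNorm_nonneg hq A).lt_of_ne' fun h => hA (eq_zero_of_schattenNorm_eq_zero hq h)
  have hdec : Ω A = ∑ x : ν × ν, A x.1 x.2 • Ω (single x.1 x.2 1) := by
    conv_lhs => rw [matrix_eq_sum_single A]
    simp only [map_sum, Fintype.sum_prod_type, ← map_smul, smul_single, smul_eq_mul, mul_one]
  rw [div_le_iff₀ hpos, hdec, Finset.sum_mul]
  refine (schattenNorm_sum_le hp _).trans (Finset.sum_le_sum fun x _ => ?_)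
  rw [schattenNorm_smul hp0, mul_comm]
  exact mul_le_mul_of_nonneg_left (norm_apply_le_schattenNorm hq A _ _)
    (schattenNorm_nonneg hp0 _)

theorem schattenNorm_apply_le {q p : ℝ} (hq : 0 < q) (hp : 1 ≤ p) (Ω : Superoperator ν μ)
    (A : Matrix ν ν ℂ) :
    schattenNorm p (Ω A) ≤ (outputPurity q p Ω).toReal * schattenNorm q A := by
  by_cases hA : A = 0
  · rw [hA, map_zero, schattenNorm_zero (by linarith), schattenNorm_zero hq, mul_zero]
  · have hpos : 0 < schattenNorm q A :=
      (schattenNorm_nonneg hq A).lt_of_ne' fun h => hA (eq_zero_of_schattenNorm_eq_zero hq h)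
    rw [← div_le_iff₀ hpos]
    refine (ENNReal.ofReal_le_iff_le_toReal (outputPurity_ne_top hq hp Ω)).1 ?_
    exact le_iSup₂_of_le (f := fun (A : Matrix ν ν ℂ) (_ : A ≠ 0) =>
      ENNReal.ofReal (schattenNorm p (Ω A) / schattenNorm q A)) A hA le_rfl

/-- The constants `c₁` and `c₂` hold the costs of the output and input block comparisons, so that
one argument serves all three exponent ranges. -/
theorem schattenNorm_tensorMap_le {q p c₁ c₂ : ℝ} (hq : 1 ≤ q) (hp : 0 < p) (hc₁ : 0 ≤ c₁)
    (hc₂ : 0 ≤ c₂) (Φ : Superoperator ι κ) (Ω : Superoperator ν μ) {N : ℝ} (hN : 0 ≤ N)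
    (hΩ : ∀ A, schattenNorm p (Ω A) ≤ N * schattenNorm q A)
    (h₁ : ∀ B : Matrix (κ × μ) (κ × μ) ℂ, schattenNorm p B ^ 2 ≤
      c₁ ^ 2 * ∑ l : κ, ∑ k : κ, schattenNorm p (block B k l) ^ 2)
    (h₂ : ∀ A : Matrix (ι × ν) (ι × ν) ℂ,
      ∑ j : ι, ∑ i : ι, schattenNorm q (block A i j) ^ 2 ≤ c₂ ^ 2 * schattenNorm q A ^ 2)
    (A : Matrix (ι × ν) (ι × ν) ℂ) :
    schattenNorm p (tensorMap Φ Ω A) ≤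
      c₁ * c₂ * schattenNorm 2 (choiMatrix Φ) * N * schattenNorm q A := by
  have hq0 : 0 < q := by linarith
  have hX := schattenNorm_nonneg two_pos (choiMatrix Φ)
  have hA0 := schattenNorm_nonneg hq0 A
  have h₂' : ∑ x : ι × ι, schattenNorm q (block A x.1 x.2) ^ 2 ≤
      c₂ ^ 2 * schattenNorm q A ^ 2 := by
    rw [Fintype.sum_prod_type_right]
    exact h₂ A
  have hblock : ∀ k l, schattenNorm p (block (tensorMap Φ Ω A) k l) ^ 2 ≤
      (∑ x : ι × ι, ‖Φ (single x.1 x.2 1) k l‖ ^ 2) *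
        (N ^ 2 * (c₂ ^ 2 * schattenNorm q A ^ 2)) := by
    intro k l
    rw [block_tensorMap]
    have h3 := (hΩ _).trans (mul_le_mul_of_nonneg_left (schattenNorm_sum_le hq
      fun x : ι × ι => Φ (single x.1 x.2 1) k l • block A x.1 x.2) hN)
    simp only [schattenNorm_smul hq0] at h3
    refine (pow_le_pow_left₀ (schattenNorm_nonneg hp _) h3 2).trans ?_
    rw [mul_pow, mul_left_comm]
    refine mul_le_mul_of_nonneg_left ?_ (by positivity)
    -- Cauchy–Schwarz over the pairs `(i, j)` separates the Choi entries from the block norms of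
    -- `A`.
    exact (Finset.sum_mul_sq_le_sq_mul_sq _ _ _).trans
      (mul_le_mul_of_nonneg_left h₂' (by positivity))
  refine le_of_sq_le_sq ?_ (by positivity)
  calc schattenNorm p (tensorMap Φ Ω A) ^ 2
      ≤ c₁ ^ 2 * ∑ l : κ, ∑ k : κ, schattenNorm p (block (tensorMap Φ Ω A) k l) ^ 2 := h₁ _
    _ ≤ c₁ ^ 2 * ∑ l : κ, ∑ k : κ, (∑ x : ι × ι, ‖Φ (single x.1 x.2 1) k l‖ ^ 2) *
        (N ^ 2 * (c₂ ^ 2 * schattenNorm q A ^ 2)) := by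
        gcongr with l _ k _
        exact hblock k l
    _ = _ := by
        simp only [← Finset.sum_mul]
        rw [← schattenNorm_two_choiMatrix_sq]
        ring

theorem potentialPurity_le {q p c₁ c₂ : ℝ} (hq : 1 ≤ q) (hp : 1 ≤ p) (hc₁ : 0 ≤ c₁)
    (hc₂ : 0 ≤ c₂) (Φ : Superoperator ι κ)
    (h₁ : ∀ (m : ℕ) (B : Matrix (κ × Fin m) (κ × Fin m) ℂ), schattenNorm p B ^ 2 ≤
      c₁ ^ 2 * ∑ l : κ, ∑ k : κ, schattenNorm p (block B k l) ^ 2)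
    (h₂ : ∀ (n : ℕ) (A : Matrix (ι × Fin n) (ι × Fin n) ℂ),
      ∑ j : ι, ∑ i : ι, schattenNorm q (block A i j) ^ 2 ≤ c₂ ^ 2 * schattenNorm q A ^ 2) :
    potentialPurity q p Φ ≤ ENNReal.ofReal (c₁ * c₂ * schattenNorm 2 (choiMatrix Φ)) := by
  have hq0 : 0 < q := by linarith
  have hX := schattenNorm_nonneg two_pos (choiMatrix Φ)
  refine iSup₂_le fun n _ => iSup₂_le fun m _ => iSup₂_le fun Ω _ => iSup_le fun _ => ?_
  refine ENNReal.div_le_of_le_mul (iSup₂_le fun A hA => ?_)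
  have hpos : 0 < schattenNorm q A :=
    (schattenNorm_nonneg hq0 A).lt_of_ne' fun h => hA (eq_zero_of_schattenNorm_eq_zero hq0 h)
  rw [← ENNReal.ofReal_toReal (outputPurity_ne_top hq0 hp Ω), ← ENNReal.ofReal_mul (by positivity)]
  refine ENNReal.ofReal_le_ofReal ?_
  rw [div_le_iff₀ hpos]
  exact schattenNorm_tensorMap_le hq (by linarith) hc₁ hc₂ Φ Ω ENNReal.toReal_nonneg
    (schattenNorm_apply_le hq0 hp Ω) (h₁ m) (h₂ n) A

end Bound

end OutputPurity

theorem theorem1 (d d' : ℕ) (Φ : OutputPurity.Superoperator (Fin d) (Fin d'))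
    (hΦ : OutputPurity.IsCompletelyPositive Φ) (q p : ℝ) (hq : 1 ≤ q) (hp : 1 ≤ p) :
    (q ≤ 2 → 2 ≤ p →
      OutputPurity.potentialPurity q p Φ ≤
        ENNReal.ofReal (OutputPurity.schattenNorm 2 (OutputPurity.choiMatrix Φ))) ∧
    (2 < q → q < p →
      OutputPurity.potentialPurity q p Φ ≤
        ENNReal.ofReal ((d : ℝ) ^ (1 - 2 / q) *
          OutputPurity.schattenNorm 2 (OutputPurity.choiMatrix Φ))) ∧
    (q < p → p < 2 →
      OutputPurity.potentialPurity q p Φ ≤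
        ENNReal.ofReal ((d' : ℝ) ^ (2 / p - 1) *
          OutputPurity.schattenNorm 2 (OutputPurity.choiMatrix Φ))) := by
  have hq0 : 0 < q := by linarith
  have hp0 : 0 < p := by linarith
  -- For `q ≤ 2 ≤ p` both comparisons are free. For `2 < q < p` only the input costs `d ^ (1 - 2 /
  -- q)`; for `q < p < 2` only the output costs `d' ^ (2 / p - 1)`.
  refine ⟨fun hq2 hp2 => ?_, fun hq2 hqp => ?_, fun hqp hp2 => ?_⟩
  · have h := OutputPurity.potentialPurity_le hq hp zero_le_one zero_le_one Φ
      (fun m B => by simpa using OutputPurity.schattenNorm_sq_le_sum_blocks hp2 B)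
      (fun n A => by simpa using OutputPurity.sum_blocks_le_schattenNorm_sq hq0 hq2 A)
    simpa using h
  · have h := OutputPurity.potentialPurity_le hq hp zero_le_one
      (c₂ := (d : ℝ) ^ (1 - 2 / q)) (by positivity) Φ
      (fun m B => by simpa using OutputPurity.schattenNorm_sq_le_sum_blocks (by linarith) B)
      (fun n A => by
        simpa using OutputPurity.sum_blocks_le_card_mul_schattenNorm_sq hq2.le A)
    simpa using h
  · have h := OutputPurity.potentialPurity_le hq hp
      (c₁ := (d' : ℝ) ^ (2 / p - 1)) (by positivity) zero_le_one Φ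
      (fun m B => by
        simpa using OutputPurity.schattenNorm_sq_le_card_mul_sum_blocks hp0 hp2.le B)
      (fun n A => by
        simpa using OutputPurity.sum_blocks_le_schattenNorm_sq hq0 (by linarith) A)
    simpa using h
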